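/- **Setting.** Let $d\in\{1,2,3\}$, let $\Omega\subset\mathbb R^d$ be a bounded domain (nonempty, open, connected) and let $\mathcal T_h$ be a finite conforming (face-to-face) partition of $\overline\Omega$ into nondegenerate closed $d$-simplices. For $T\in\mathcal T_h$ put $\overline h_T=\operatorname{diam}T$, $h_T=|T|^{1/d}$, $\underline h_T=2\sup\{r>0: B(x,r)\subset T \text{ for some } x\in T\}$. The mesh is *shape regular with constant* $\sigma\ge 1$ if $\underline h_T\le h_T\le\overline h_T\le\sigma\,\underline h_T$ for all $T\in\mathcal T_h$. Let $a:\Omega\to\mathbb R$ be measurable with $\alpha_0\le a(x)\le\alpha_1$ for almost every $x\in\Omega$, for some positive constants $\alpha_0,\alpha_1$. Let $V_h$ be the space of continuous functions on $\overline\Omega$ that are affine on each $T\in\mathcal T_h$, let $\{\phi_i\}_{i=1}^N$ be its nodal basis, $\phi_i(x_j)=\delta_{ij}$, where $x_1,\dots,x_N$ are all the vertices of the mesh, including those on $\partial\Omega$, and let $A=(a_{ij})$, $$a_{ij}=\int_\Omega a(x)\,\nabla\phi_j\cdot\nabla\phi_i\,dx ,$$ be the stiffness matrix of the pure Neumann problem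 $-\nabla\cdot(a\nabla u)=f$ in $\Omega$, $(a\nabla u)\cdot n=0$ on $\partial\Omega$. Let $\mathcal E$ be the set of edges $e=(i,j)$ of the triangulation, $\omega_e=-a_{ij}$, $\mathcal E^+=\{e\in\mathcal E: a_{ij}<0\}$, and define $A_+$ by $$(A_+u,v)=\sum_{e=(i,j)\in\mathcal E^+}\omega_e\,(u_i-u_j)(v_i-v_j),\qquad u,v\in\mathbb R^N .$$ A symmetric matrix is called an *$M$-matrix* here if its diagonal entries are positive, its off-diagonal entries are nonpositive, and it is positive semidefinite. **Theorem.** For every $\sigma\ge 1$ there are constants $c,C>0$, depending only on $\sigma$, such that for every $d$, $\Omega$, $a$ as above and every mesh $\mathcal T_h$ that is shape regular with constant $\sigma$: 1. $A_+$ is the matrix obtained from $A$ by setting all positive off-diagonal entries to zero and adding them to the diagonal entry of their row. 2. $A_+$ is an $M$-matrix relative of $A$, that is, $A_+$ is an $M$-matrix and for all $v\in\mathbb R^N$ $$(A_+v,v)\le C\,(Av,v),\qquad (Dv,v)\le C\,(D_+v,v),$$ where $D$ and $D_+$ are the diagonals of $A$ and $A_+$. 3. $A_+$ is spectrally equivalent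 to $A$: $\;c\,(Av,v)\le(A_+v,v)\le C\,(Av,v)$ for all $v\in\mathbb R^N$. 4. The graph of $A_+$ (vertices $1,\dots,N$; $i\ne j$ joined if and only if $(A_+)_{ij}\ne0$) is connected. -/

import Mathlib

open MeasureTheory

noncomputable section

/-- A conforming (face-to-face) finite simplicial mesh of the domain `Ω ⊆ ℝᵈ`: a finite geometric
simplicial complex, every face of which is a face of a `d`-dimensional simplex, and whose simplices
fill out the closed region `closure Ω`. -/
structure SimplicialMesh (d : ℕ) (Ω : Set (EuclideanSpace ℝ (Fin d))) extends
    Geometry.SimplicialComplex ℝ (EuclideanSpace ℝ (Fin d)) where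
  finite_faces : faces.Finite
  pure : ∀ s ∈ faces, ∃ t ∈ faces, s ⊆ t ∧ t.card = d + 1
  space_eq : toSimplicialComplex.space = closure Ω

namespace SimplicialMesh

variable {d : ℕ} {Ω : Set (EuclideanSpace ℝ (Fin d))}

/-- The elements of the mesh (each given by its set of `d + 1` vertices). -/
def elements (M : SimplicialMesh d Ω) : Set (Finset (EuclideanSpace ℝ (Fin d))) :=
  {t | t ∈ M.faces ∧ t.card = d + 1}

/-- The closed simplex spanned by a set of vertices. -/
abbrev cell (t : Finset (EuclideanSpace ℝ (Fin d))) : Set (EuclideanSpace ℝ (Fin d)) :=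
  convexHull ℝ (t : Set (EuclideanSpace ℝ (Fin d)))

/-- The nodes (vertices) of the mesh. For the pure Neumann problem all of them, including those on
the boundary, are degrees of freedom. -/
abbrev Node (M : SimplicialMesh d Ω) : Type :=
  {x : EuclideanSpace ℝ (Fin d) // x ∈ M.toSimplicialComplex.vertices}

theorem finite_vertices (M : SimplicialMesh d Ω) : M.toSimplicialComplex.vertices.Finite := by
  rw [Geometry.SimplicialComplex.vertices_eq]
  exact M.finite_faces.biUnion fun s _ => s.finite_toSet

instance instFintypeNode (M : SimplicialMesh d Ω) : Fintype M.Node :=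
  M.finite_vertices.fintype

instance instDecidableEqNode (M : SimplicialMesh d Ω) : DecidableEq M.Node :=
  Classical.decEq _

/-- The graph of the triangulation: two distinct nodes are joined by an edge when they are vertices
of a common simplex. -/
def edgeGraph (M : SimplicialMesh d Ω) : SimpleGraph M.Node where
  Adj i j := i ≠ j ∧ ∃ t ∈ M.faces, i.1 ∈ t ∧ j.1 ∈ t
  symm := ⟨fun _ _ h => ⟨h.1.symm, h.2.imp fun _ ht => ⟨ht.1, ht.2.2, ht.2.1⟩⟩⟩
  loopless := ⟨fun _ h => h.1 rfl⟩

/-! ### Shape regularity -/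

/-- `diam T`. -/
def hUpper (T : Set (EuclideanSpace ℝ (Fin d))) : ℝ := Metric.diam T

/-- `|T|^(1/d)`. -/
def hMid (T : Set (EuclideanSpace ℝ (Fin d))) : ℝ := (volume.real T) ^ (1 / (d : ℝ))

/-- Twice the supremum of the radii of the balls contained in `T`. -/
def hLower (T : Set (EuclideanSpace ℝ (Fin d))) : ℝ :=
  2 * sSup {r : ℝ | 0 < r ∧ ∃ x ∈ T, Metric.ball x r ⊆ T}

/-- The mesh is shape regular with shape regularity constant `σ`. -/
def IsShapeRegular (M : SimplicialMesh d Ω) (σ : ℝ) : Prop :=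
  ∀ t ∈ M.elements, hLower (cell t) ≤ hMid (cell t) ∧ hMid (cell t) ≤ hUpper (cell t) ∧
    hUpper (cell t) ≤ σ * hLower (cell t)

/-! ### The linear finite element space and its nodal basis -/

/-- The space of continuous functions on `closure Ω` that are affine on every element. (Values
outside `closure Ω` are irrelevant.) -/
def feSpace (M : SimplicialMesh d Ω) : Submodule ℝ (EuclideanSpace ℝ (Fin d) → ℝ) where
  carrier := {v | ContinuousOn v (closure Ω) ∧
    ∀ t ∈ M.elements, ∃ f : EuclideanSpace ℝ (Fin d) →ᵃ[ℝ] ℝ, Set.EqOn v f (cell t)}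
  zero_mem' := ⟨continuousOn_const, fun _ _ => ⟨0, fun _ _ => rfl⟩⟩
  add_mem' := by
    rintro u v ⟨hu, hu'⟩ ⟨hv, hv'⟩
    refine ⟨hu.add hv, fun t ht => ?_⟩
    obtain ⟨f, hf⟩ := hu' t ht
    obtain ⟨g, hg⟩ := hv' t ht
    exact ⟨f + g, fun x hx => by simp [hf hx, hg hx]⟩
  smul_mem' := by
    rintro c u ⟨hu, hu'⟩
    refine ⟨hu.const_smul c, fun t ht => ?_⟩
    obtain ⟨f, hf⟩ := hu' t ht
    exact ⟨c • f, fun x hx => by simp [hf hx]⟩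

theorem exists_element_of_mem (M : SimplicialMesh d Ω) {x : EuclideanSpace ℝ (Fin d)}
    (hx : x ∈ closure Ω) : ∃ t ∈ M.elements, x ∈ cell t := by
  rw [← M.space_eq, Geometry.SimplicialComplex.mem_space_iff] at hx
  obtain ⟨s, hs, hxs⟩ := hx
  obtain ⟨t, ht, hst, hc⟩ := M.pure s hs
  exact ⟨t, ⟨ht, hc⟩, convexHull_mono (by exact_mod_cast hst) hxs⟩

theorem cell_subset (M : SimplicialMesh d Ω) {t : Finset (EuclideanSpace ℝ (Fin d))}
    (ht : t ∈ M.elements) : cell t ⊆ closure Ω := by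
  rw [← M.space_eq]
  exact Geometry.SimplicialComplex.convexHull_subset_space ht.1

theorem affine_eqOn_convexHull {s : Set (EuclideanSpace ℝ (Fin d))}
    {f g : EuclideanSpace ℝ (Fin d) →ᵃ[ℝ] ℝ} (h : Set.EqOn f g s) :
    Set.EqOn f g (convexHull ℝ s) :=
  fun _ hx => AffineMap.eqOn_affineSpan h (convexHull_subset_affineSpan s hx)

/-- Existence of the finite element interpolant of arbitrary nodal values. -/
theorem exists_interpolant (M : SimplicialMesh d Ω) (c : M.Node → ℝ) :
    ∃ v ∈ M.feSpace, ∀ j : M.Node, v j.1 = c j := by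
  classical
  let u : EuclideanSpace ℝ (Fin d) → ℝ := fun x => if h : x ∈ M.vertices then c ⟨x, h⟩ else 0
  have loc : ∀ t : M.elements, ∃ f : EuclideanSpace ℝ (Fin d) →ᵃ[ℝ] ℝ,
      ∀ x ∈ t.1, f x = u x := by
    rintro ⟨t, ht, hc⟩
    have hi := M.indep ht
    have htop : affineSpan ℝ (Set.range ((↑) : t → EuclideanSpace ℝ (Fin d))) = ⊤ := by
      rw [hi.affineSpan_eq_top_iff_card_eq_finrank_add_one]
      simp [hc]
    let b : AffineBasis t ℝ (EuclideanSpace ℝ (Fin d)) := ⟨(↑), hi, htop⟩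
    refine ⟨∑ i : t, u i.1 • b.coord i, fun x hx => ?_⟩
    have hb : ∀ i : t, b.coord i x = if i = ⟨x, hx⟩ then 1 else 0 := by
      intro i
      have := b.coord_apply i ⟨x, hx⟩
      have hbx : b ⟨x, hx⟩ = x := rfl
      rwa [hbx] at this
    have hs : ∀ s : Finset t,
        (∑ i ∈ s, u i.1 • b.coord i : EuclideanSpace ℝ (Fin d) →ᵃ[ℝ] ℝ) x
          = ∑ i ∈ s, u i.1 * b.coord i x := by
      intro s
      induction s using Finset.induction_on with
      | empty => simp
      | insert a s ha ih => simp [Finset.sum_insert ha, ih]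
    rw [hs, Finset.sum_congr rfl fun i _ => by rw [hb i]]
    simp
  choose f hf using loc
  have agree : ∀ s t : M.elements, ∀ x, x ∈ cell s.1 → x ∈ cell t.1 → f s x = f t x := by
    intro s t x hs ht
    refine affine_eqOn_convexHull (s := (s.1 ∩ t.1 : Set _)) (fun y hy => ?_)
      (M.inter_subset_convexHull s.2.1 t.2.1 ⟨hs, ht⟩)
    rw [hf s y hy.1, hf t y hy.2]
  let v : EuclideanSpace ℝ (Fin d) → ℝ := fun x =>
    if h : ∃ t : M.elements, x ∈ cell t.1 then f h.choose x else 0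
  have hv : ∀ t : M.elements, Set.EqOn v (f t) (cell t.1) := by
    intro t x hx
    have h : ∃ t : M.elements, x ∈ cell t.1 := ⟨t, hx⟩
    simp only [v, dif_pos h]
    exact agree _ _ _ h.choose_spec hx
  refine ⟨v, ⟨?_, fun t ht => ⟨f ⟨t, ht⟩, hv ⟨t, ht⟩⟩⟩, fun j => ?_⟩
  · have hfin : Finite M.elements := (M.finite_faces.subset fun t ht => ht.1).to_subtype
    have : closure Ω = ⋃ t : M.elements, cell t.1 := by
      ext x
      constructor
      · intro hx
        obtain ⟨t, ht, hxt⟩ := M.exists_element_of_mem hx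
        exact Set.mem_iUnion.2 ⟨⟨t, ht⟩, hxt⟩
      · intro hx
        obtain ⟨t, hxt⟩ := Set.mem_iUnion.1 hx
        exact M.cell_subset t.2 hxt
    rw [this]
    refine (locallyFinite_of_finite _).continuousOn_iUnion
      (fun t => (t.1.finite_toSet.isCompact_convexHull (𝕜 := ℝ)).isClosed) fun t => ?_
    exact ((f t).continuous_of_finiteDimensional.continuousOn).congr (hv t)
  · obtain ⟨t, ht, hjt, hc⟩ := M.pure _ j.2
    have hj : j.1 ∈ t := hjt (Finset.mem_singleton_self _)
    rw [hv ⟨t, ht, hc⟩ (subset_convexHull ℝ _ hj), hf _ _ hj]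
    simp only [u]
    rw [dif_pos j.2]

/-- A finite element function is determined on `closure Ω` by its nodal values. -/
theorem feSpace_eqOn (M : SimplicialMesh d Ω) {u v : EuclideanSpace ℝ (Fin d) → ℝ}
    (hu : u ∈ M.feSpace) (hv : v ∈ M.feSpace) (h : ∀ j : M.Node, u j.1 = v j.1) :
    Set.EqOn u v (closure Ω) := by
  intro x hx
  obtain ⟨t, ht, hxt⟩ := M.exists_element_of_mem hx
  obtain ⟨f, hf⟩ := hu.2 t ht
  obtain ⟨g, hg⟩ := hv.2 t ht
  rw [hf hxt, hg hxt]
  refine affine_eqOn_convexHull (fun y hy => ?_) hxt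
  have hy' : y ∈ M.toSimplicialComplex.vertices :=
    M.down_closed ht.1 (Finset.singleton_subset_iff.2 hy) (Finset.singleton_nonempty _)
  rw [← hf (subset_convexHull ℝ _ hy), ← hg (subset_convexHull ℝ _ hy)]
  exact h ⟨y, hy'⟩

theorem exists_nodalBasis (M : SimplicialMesh d Ω) (i : M.Node) :
    ∃ v ∈ M.feSpace, ∀ j : M.Node, v j.1 = if i = j then 1 else 0 :=
  M.exists_interpolant fun j => if i = j then 1 else 0

/-- The nodal basis function `φ i`: the finite element function with `φ i (x_j) = δ_ij`. -/
def nodalBasis (M : SimplicialMesh d Ω) (i : M.Node) : EuclideanSpace ℝ (Fin d) → ℝ :=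
  (M.exists_nodalBasis i).choose

theorem nodalBasis_mem (M : SimplicialMesh d Ω) (i : M.Node) : M.nodalBasis i ∈ M.feSpace :=
  (M.exists_nodalBasis i).choose_spec.1

theorem nodalBasis_apply (M : SimplicialMesh d Ω) (i j : M.Node) :
    M.nodalBasis i j.1 = if i = j then 1 else 0 :=
  (M.exists_nodalBasis i).choose_spec.2 j

end SimplicialMesh

/-- The bilinear form `a(u, v) = ∫_Ω a(x) ∇u · ∇v dx` of the Neumann problem for `-∇·(a ∇u) = f`.
On piecewise affine functions the classical gradient exists almost everywhere and is the weak
gradient. -/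
def energyForm {d : ℕ} (Ω : Set (EuclideanSpace ℝ (Fin d))) (a : EuclideanSpace ℝ (Fin d) → ℝ)
    (u v : EuclideanSpace ℝ (Fin d) → ℝ) : ℝ :=
  ∫ x in Ω, a x * inner ℝ (gradient u x) (gradient v x)

/-- The stiffness matrix `A_ij = a(φ_j, φ_i)` of the linear finite element discretization. -/
def SimplicialMesh.stiffness {d : ℕ} {Ω : Set (EuclideanSpace ℝ (Fin d))} (M : SimplicialMesh d Ω)
    (a : EuclideanSpace ℝ (Fin d) → ℝ) : Matrix M.Node M.Node ℝ :=
  Matrix.of fun i j => energyForm Ω a (M.nodalBasis j) (M.nodalBasis i)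

section MatrixNotions

variable {ι : Type*} [Fintype ι] [DecidableEq ι]

/-- `(u, v)_A = (A u, v)`. -/
def aInner (A : Matrix ι ι ℝ) (u v : ι → ℝ) : ℝ := dotProduct (A.mulVec u) v

/-- The diagonal matrix with the same diagonal as `A`. -/
def diagPart (A : Matrix ι ι ℝ) : Matrix ι ι ℝ := Matrix.diagonal A.diag

/-- `M`-matrix, in the semidefinite sense (`PosSemidef` includes symmetry). -/
structure IsMMatrix (A : Matrix ι ι ℝ) : Prop where
  diag_pos : ∀ i, 0 < A i i
  offDiag_nonpos : ∀ i j, i ≠ j → A i j ≤ 0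
  posSemidef : A.PosSemidef

/-- `B` is an `M`-matrix relative of `A`, with constant `C` in both inequalities. -/
structure IsMMatrixRelative (C : ℝ) (A B : Matrix ι ι ℝ) : Prop where
  isMMatrix : IsMMatrix B
  energy_le : ∀ v, aInner B v v ≤ C * aInner A v v
  diag_le : ∀ v, aInner (diagPart A) v v ≤ C * aInner (diagPart B) v v

/-- `A` and `B` are spectrally equivalent with constants `c` and `C`. -/
def SpectrallyEquivalent (c C : ℝ) (A B : Matrix ι ι ℝ) : Prop :=
  ∀ v, c * aInner A v v ≤ aInner B v v ∧ aInner B v v ≤ C * aInner A v v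

/-- The graph of a symmetric matrix: `i` and `j` are joined when `i ≠ j` and `A_ij ≠ 0`. -/
def matrixGraph (A : Matrix ι ι ℝ) : SimpleGraph ι :=
  SimpleGraph.fromRel fun i j => A i j ≠ 0

open Classical in
/-- The form `∑_{e = (i, j) ∈ E⁺} ω_e (u_i - u_j) (v_i - v_j)`, where `ω_e = -a_ij` and `E⁺` is the
set of edges of the graph `G` with `a_ij < 0`. Every edge occurs twice in the double sum. -/
def plusForm (G : SimpleGraph ι) (A : Matrix ι ι ℝ) (u v : ι → ℝ) : ℝ :=
  (1 / 2) * ∑ i, ∑ j,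
    if G.Adj i j ∧ A i j < 0 then -A i j * (u i - u j) * (v i - v j) else 0

/-- The matrix `A₊` of the form `plusForm`, `(A₊ u, v) = plusForm G A u v`. -/
def plusMatrix (G : SimpleGraph ι) (A : Matrix ι ι ℝ) : Matrix ι ι ℝ :=
  Matrix.of fun i j => plusForm G A (Pi.single j 1) (Pi.single i 1)

theorem aInner_plusMatrix (G : SimpleGraph ι) (A : Matrix ι ι ℝ) (u v : ι → ℝ) :
    aInner (plusMatrix G A) u v = plusForm G A u v := by
  classical
  let B : LinearMap.BilinForm ℝ (ι → ℝ) := LinearMap.mk₂ ℝ (plusForm G A)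
    (fun x y z => by
      simp only [plusForm, ← mul_add, ← Finset.sum_add_distrib]
      refine congrArg _ (Finset.sum_congr rfl fun i _ => Finset.sum_congr rfl fun j _ => ?_)
      split_ifs <;> simp; ring)
    (fun c x z => by
      simp only [plusForm, smul_eq_mul, mul_left_comm c, Finset.mul_sum]
      refine Finset.sum_congr rfl fun i _ => Finset.sum_congr rfl fun j _ => ?_
      split_ifs <;> simp; ring)
    (fun x y z => by
      simp only [plusForm, ← mul_add, ← Finset.sum_add_distrib]
      refine congrArg _ (Finset.sum_congr rfl fun i _ => Finset.sum_congr rfl fun j _ => ?_)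
      split_ifs <;> simp; ring)
    (fun c x z => by
      simp only [plusForm, smul_eq_mul, mul_left_comm c, Finset.mul_sum]
      refine Finset.sum_congr rfl fun i _ => Finset.sum_congr rfl fun j _ => ?_
      split_ifs <;> simp; ring)
  have hB : ∀ x y, plusForm G A x y = B x y := fun _ _ => rfl
  have hu : u = ∑ j, u j • (Pi.single j 1 : ι → ℝ) := by
    simpa using (pi_eq_sum_univ' u)
  have hv : v = ∑ i, v i • (Pi.single i 1 : ι → ℝ) := by
    simpa using (pi_eq_sum_univ' v)
  conv_rhs => rw [hB, hu, hv]
  simp only [map_sum, LinearMap.sum_apply, map_smul, LinearMap.smul_apply, smul_eq_mul, ← hB,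
    aInner, dotProduct, Matrix.mulVec, plusMatrix, Matrix.of_apply, Finset.sum_mul]
  refine Finset.sum_congr rfl fun i _ => ?_
  rw [Finset.mul_sum]
  exact Finset.sum_congr rfl fun j _ => by ring

/-- The matrix obtained from `A` by setting the positive off-diagonal entries to zero and adding
them to the diagonal of their row. -/
def diagCompensated (A : Matrix ι ι ℝ) : Matrix ι ι ℝ :=
  Matrix.of fun i j =>
    if i = j then A i i + ∑ k ∈ Finset.univ.erase i, max (A i k) 0 else min (A i j) 0

end MatrixNotions

end

/-! ### Symmetric matrices with zero row sums. -/

section Algebra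

variable {ι : Type*} [Fintype ι]

/-! The nodal basis is a partition of unity, so the stiffness matrix has zero row sums. With
symmetry this gives `(Av,v) = ½ ∑ -a_ij (v_i - v_j)²`. Passing to `A₊` discards exactly the terms
with `a_ij > 0`, which are nonpositive; hence `A ≤ A₊` and `c = 1` (`aInner_le_plusForm`).

For the upper bound, replace the weight by `∫ a |∇φ_j · ∇φ_i|` and argue pointwise under the
integral (`sum_abs_inner_gradient_mul_le`). On an element `T`, with `u` the interpolant of `v`,
`|∇φ_i| ≤ 1/hLower T` and `|v_i - v_j| ≤ |∇u| diam T`; the sizes cancel up to `σ²`, and at most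
`(d+1)²` pairs contribute. The factor `a(x)` stands on both sides, so its bounds never enter the
constant.

A vector of zero `A`-energy is constant because `Ω` is connected. By `A ≤ A₊` the same holds for
`A₊`, and the indicator of a connected component of its graph then shows that there is only one. -/

theorem aInner_eq_half_sum {A : Matrix ι ι ℝ} (hs : ∀ i j, A i j = A j i)
    (h0 : ∀ i, ∑ j, A i j = 0) (v : ι → ℝ) :
    aInner A v v = (1 / 2) * ∑ i, ∑ j, -A i j * (v i - v j) * (v i - v j) := by
  have e : ∀ i j, -A i j * (v i - v j) * (v i - v j) =
      2 * (A i j * v j * v i) - A i j * v i ^ 2 - A j i * v j ^ 2 := by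
    intro i j; rw [hs j i]; ring
  have h1 : ∑ i, ∑ j, A i j * v i ^ 2 = 0 := by
    simp only [← Finset.sum_mul, h0, zero_mul, Finset.sum_const_zero]
  have h2 : ∑ i, ∑ j, A j i * v j ^ 2 = 0 := by rw [Finset.sum_comm]; exact h1
  simp only [e, Finset.sum_sub_distrib, h1, h2, ← Finset.mul_sum, aInner, dotProduct,
    Matrix.mulVec, Finset.sum_mul]
  ring

theorem plusForm_self_eq (G : SimpleGraph ι) {A : Matrix ι ι ℝ}
    (hadj : ∀ i j, i ≠ j → A i j < 0 → G.Adj i j) (v : ι → ℝ) :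
    plusForm G A v v = (1 / 2) * ∑ i, ∑ j, max (-A i j) 0 * (v i - v j) * (v i - v j) := by
  unfold plusForm
  refine congrArg _ (Finset.sum_congr rfl fun i _ => Finset.sum_congr rfl fun j _ => ?_)
  rcases eq_or_ne i j with rfl | hij
  · simp
  by_cases h : A i j < 0
  · rw [if_pos ⟨hadj i j hij h, h⟩, max_eq_left (by linarith)]
  · rw [if_neg (fun h' => h h'.2), max_eq_right (by linarith)]; simp

theorem aInner_le_plusForm (G : SimpleGraph ι) {A : Matrix ι ι ℝ} (hs : ∀ i j, A i j = A j i)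
    (h0 : ∀ i, ∑ j, A i j = 0) (hadj : ∀ i j, i ≠ j → A i j < 0 → G.Adj i j) (v : ι → ℝ) :
    aInner A v v ≤ plusForm G A v v := by
  rw [aInner_eq_half_sum hs h0, plusForm_self_eq G hadj]
  refine mul_le_mul_of_nonneg_left
    (Finset.sum_le_sum fun i _ => Finset.sum_le_sum fun j _ => ?_) (by norm_num)
  rw [mul_assoc, mul_assoc]
  exact mul_le_mul_of_nonneg_right (le_max_left _ _) (mul_self_nonneg _)

variable [DecidableEq ι]

theorem plusMatrix_eq_diagCompensated (G : SimpleGraph ι) {A : Matrix ι ι ℝ}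
    (hs : ∀ i j, A i j = A j i) (h0 : ∀ i, ∑ j, A i j = 0)
    (hadj : ∀ i j, i ≠ j → A i j < 0 → G.Adj i j) :
    plusMatrix G A = diagCompensated A := by
  classical
  ext i j
  -- The diagonal weight is set to zero because no sign of `A k k` is assumed; it multiplies `u k -
  -- u k` anyway.
  set w : ι → ι → ℝ := fun k l => if k = l then 0 else -min (A k l) 0 with hw
  have hws : ∀ k l, w k l = w l k := by
    intro k l; simp only [hw, hs k l, eq_comm (a := k)]
  have key : ∀ u v : ι → ℝ, plusForm G A u v =
      (1 / 2) * ∑ k, ∑ l, w k l * (u k - u l) * (v k - v l) := by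
    intro u v
    unfold plusForm
    refine congrArg _ (Finset.sum_congr rfl fun k _ => Finset.sum_congr rfl fun l _ => ?_)
    rcases eq_or_ne k l with rfl | hkl
    · simp
    by_cases h : A k l < 0
    · rw [if_pos ⟨hadj k l hkl h, h⟩]; simp [hw, hkl, min_eq_left h.le]
    · rw [if_neg (fun h' => h h'.2)]; simp [hw, hkl, min_eq_right (not_lt.1 h)]
  have expand : ∀ u v : ι → ℝ, plusForm G A u v =
      ∑ k, (∑ l, w k l) * (u k * v k) - ∑ k, ∑ l, w k l * u l * v k := by
    intro u v
    -- Indices of `w` are swapped in two terms so that exchanging the summations merges the four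
    -- sums into two equal pairs, cancelling the factor `1 / 2`.
    have e : ∀ k l, w k l * (u k - u l) * (v k - v l) =
        w k l * (u k * v k) + w l k * (u l * v l) - w k l * u l * v k - w l k * u k * v l := by
      intro k l; rw [hws l k]; ring
    have h1 : ∑ k, ∑ l, w l k * (u l * v l) = ∑ k, ∑ l, w k l * (u k * v k) := Finset.sum_comm
    have h2 : ∑ k, ∑ l, w l k * u k * v l = ∑ k, ∑ l, w k l * u l * v k := Finset.sum_comm
    rw [key]
    simp only [e, Finset.sum_sub_distrib, Finset.sum_add_distrib, h1, h2, Finset.sum_mul]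
    ring
  have h2 : ∑ k, ∑ l, w k l * (Pi.single j 1 : ι → ℝ) l * (Pi.single i 1 : ι → ℝ) k = w i j := by
    simp [Pi.single_apply]
  change plusForm G A (Pi.single j 1) (Pi.single i 1) = _
  rw [expand, h2]
  rcases eq_or_ne i j with rfl | hij
  · have h3 : ∑ k, (∑ l, w k l) * ((Pi.single i 1 : ι → ℝ) k * (Pi.single i 1 : ι → ℝ) k)
        = ∑ l, w i l := by simp [Pi.single_apply]
    have h4 : w i i = 0 := by simp [hw]
    -- Zero row sum: minus the off-diagonal sum is `A i i`, to which the split `-min = max - A` adds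
    -- the positive entries.
    have h5 : A i i + ∑ k ∈ Finset.univ.erase i, A i k = 0 := by
      rw [Finset.add_sum_erase _ _ (Finset.mem_univ i)]; exact h0 i
    have h6 : ∑ l, w i l = ∑ l ∈ Finset.univ.erase i, (max (A i l) 0 - A i l) := by
      rw [← Finset.add_sum_erase _ _ (Finset.mem_univ i), h4, zero_add]
      refine Finset.sum_congr rfl fun l hl => ?_
      simp only [hw, if_neg (Finset.ne_of_mem_erase hl).symm]
      linarith [min_add_max (A i l) 0]
    rw [h3, h4, h6, Finset.sum_sub_distrib]
    simp only [diagCompensated, Matrix.of_apply, if_true]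
    linarith
  · have h3 : ∑ k, (∑ l, w k l) * ((Pi.single j 1 : ι → ℝ) k * (Pi.single i 1 : ι → ℝ) k)
        = 0 := by simp [Pi.single_apply, hij]
    rw [h3]
    simp [diagCompensated, hw, hij]

theorem isMMatrix_diagCompensated {A : Matrix ι ι ℝ} (hs : ∀ i j, A i j = A j i)
    (hpos : ∀ i, 0 < A i i) (hnn : ∀ v, 0 ≤ aInner (diagCompensated A) v v) :
    IsMMatrix (diagCompensated A) where
  diag_pos i := by
    simp only [diagCompensated, Matrix.of_apply, if_true]
    exact add_pos_of_pos_of_nonneg (hpos i) (Finset.sum_nonneg fun _ _ => le_max_right _ _)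
  offDiag_nonpos i j hij := by simp [diagCompensated, hij]
  posSemidef := by
    refine Matrix.PosSemidef.of_dotProduct_mulVec_nonneg ?_ fun v => ?_
    · ext i j
      rcases eq_or_ne i j with rfl | hij
      · simp
      · simp [diagCompensated, hij, hij.symm, hs i j]
    · have := hnn v
      rwa [aInner, dotProduct_comm] at this

/-- Compensation only increases the diagonal, so the constant 1 suffices; a general `C ≥ 1` lets the
energy bound share its constant. -/
theorem aInner_diagPart_le {A : Matrix ι ι ℝ} {C : ℝ} (hC : 1 ≤ C) (hpos : ∀ i, 0 < A i i)
    (v : ι → ℝ) :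
    aInner (diagPart A) v v ≤ C * aInner (diagPart (diagCompensated A)) v v := by
  simp only [aInner, diagPart, Matrix.mulVec_diagonal, dotProduct, Finset.mul_sum]
  refine Finset.sum_le_sum fun i _ => ?_
  have h1 : A i i ≤ C * diagCompensated A i i := by
    have : A i i ≤ diagCompensated A i i := by
      simp only [diagCompensated, Matrix.of_apply, if_true]
      exact le_add_of_nonneg_right (Finset.sum_nonneg fun _ _ => le_max_right _ _)
    nlinarith [hpos i]
  have := mul_le_mul_of_nonneg_right h1 (mul_self_nonneg (v i))
  simp only [Matrix.diag_apply]
  linarith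

/-- If the form of `plusMatrix G A` vanishes only on constant vectors, its graph is connected. -/
theorem matrixGraph_plusMatrix_connected [Nonempty ι] (G : SimpleGraph ι) {A : Matrix ι ι ℝ}
    (hs : ∀ i j, A i j = A j i) (h0 : ∀ i, ∑ j, A i j = 0)
    (hadj : ∀ i j, i ≠ j → A i j < 0 → G.Adj i j)
    (hker : ∀ v : ι → ℝ, plusForm G A v v = 0 → ∀ i j, v i = v j) :
    (matrixGraph (plusMatrix G A)).Connected := by
  classical
  rw [SimpleGraph.connected_iff]
  refine ⟨fun i j => ?_, inferInstance⟩
  set H := matrixGraph (plusMatrix G A) with hH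
  -- The indicator of the component of `i`: no negative entry of `A` joins two components, so its
  -- form vanishes.
  let v : ι → ℝ := fun k => if H.Reachable i k then 1 else 0
  have hv : v i = v j := by
    refine hker v ?_ i j
    · rw [plusForm_self_eq G hadj]
      refine mul_eq_zero_of_right _
        (Finset.sum_eq_zero fun k _ => Finset.sum_eq_zero fun l _ => ?_)
      rcases eq_or_ne k l with rfl | hkl
      · simp
      by_cases h : A k l < 0
      · have hA : H.Adj k l := by
          rw [hH, matrixGraph, SimpleGraph.fromRel_adj]
          refine ⟨hkl, Or.inl ?_⟩
          rw [plusMatrix_eq_diagCompensated G hs h0 hadj]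
          simp [diagCompensated, hkl, min_eq_left h.le, h.ne]
        have : H.Reachable i k ↔ H.Reachable i l :=
          ⟨fun h => h.trans hA.reachable, fun h => h.trans hA.symm.reachable⟩
        simp [v, this]
      · rw [max_eq_right (by linarith)]; simp
  by_contra hne
  simp [v, hne] at hv

end Algebra

/-! ### Gradient estimates on a single element. -/

namespace SimplicialMesh

variable {d : ℕ} {Ω : Set (EuclideanSpace ℝ (Fin d))}

/-- `p` is the Riesz representative of the linear part. The difference formula reaches the closed
cell, hence the vertices, where the nodal values live. -/
theorem exists_gradient (M : SimplicialMesh d Ω) {u : EuclideanSpace ℝ (Fin d) → ℝ}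
    (hu : u ∈ M.feSpace) {t : Finset (EuclideanSpace ℝ (Fin d))} (ht : t ∈ M.elements) :
    ∃ p : EuclideanSpace ℝ (Fin d), (∀ x ∈ interior (cell t), HasGradientAt u p x) ∧
      ∀ y ∈ cell t, ∀ z ∈ cell t, u y - u z = inner ℝ p (y - z) := by
  obtain ⟨f, hf⟩ := hu.2 t ht
  let L : EuclideanSpace ℝ (Fin d) →L[ℝ] ℝ := LinearMap.toContinuousLinearMap f.linear
  have hL : ∀ y z, f y - f z = L (y - z) := fun y z => (f.linearMap_vsub y z).symm
  refine ⟨(InnerProductSpace.toDual ℝ _).symm L, fun x hx => ?_, fun y hy z hz => ?_⟩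
  · rw [hasGradientAt_iff_hasFDerivAt, LinearIsometryEquiv.apply_symm_apply]
    have h1 : HasFDerivAt (fun y => L (y - x) + f x) L x := by
      simpa using (L.hasFDerivAt.comp x ((hasFDerivAt_id x).sub_const x)).add_const (f x)
    refine h1.congr_of_eventuallyEq ?_
    filter_upwards [mem_interior_iff_mem_nhds.1 hx] with y hy
    rw [hf hy, ← hL]; ring
  · rw [InnerProductSpace.toDual_symm_apply, hf hy, hf hz, hL]

theorem mem_cell {t : Finset (EuclideanSpace ℝ (Fin d))} {x : EuclideanSpace ℝ (Fin d)}
    (hx : x ∈ t) : x ∈ cell t := subset_convexHull ℝ _ hx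

theorem interior_cell_nonempty (M : SimplicialMesh d Ω)
    {t : Finset (EuclideanSpace ℝ (Fin d))} (ht : t ∈ M.elements) :
    (interior (cell t)).Nonempty := by
  rw [interior_convexHull_nonempty_iff_affineSpan_eq_top]
  have h := (M.indep ht.1).affineSpan_eq_top_iff_card_eq_finrank_add_one.2 (by simp [ht.2])
  simpa using h

theorem mem_vertices (M : SimplicialMesh d Ω) {t : Finset (EuclideanSpace ℝ (Fin d))}
    (ht : t ∈ M.elements) {x : EuclideanSpace ℝ (Fin d)} (hx : x ∈ t) :
    x ∈ M.toSimplicialComplex.vertices :=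
  M.down_closed ht.1 (Finset.singleton_subset_iff.2 hx) (Finset.singleton_nonempty _)

theorem exists_element_of_node (M : SimplicialMesh d Ω) (i : M.Node) :
    ∃ t ∈ M.elements, i.1 ∈ t := by
  obtain ⟨t, ht, hjt, hc⟩ := M.pure _ i.2
  exact ⟨t, ⟨ht, hc⟩, hjt (Finset.mem_singleton_self _)⟩

/-- The vertex values are 0 or 1, and the preimage of an interval under an affine map is convex.
Thus `φ_i` oscillates by at most 1 on a cell. -/
theorem nodalBasis_mem_Icc (M : SimplicialMesh d Ω) (i : M.Node)
    {t : Finset (EuclideanSpace ℝ (Fin d))} (ht : t ∈ M.elements)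
    {x : EuclideanSpace ℝ (Fin d)} (hx : x ∈ cell t) : M.nodalBasis i x ∈ Set.Icc (0 : ℝ) 1 := by
  obtain ⟨f, hf⟩ := (M.nodalBasis_mem i).2 t ht
  rw [hf hx]
  refine convexHull_min (t := f ⁻¹' Set.Icc 0 1) (fun y hy => ?_)
    ((convex_Icc 0 1).affine_preimage f) hx
  rw [Set.mem_preimage, ← hf (mem_cell hy), M.nodalBasis_apply i ⟨y, M.mem_vertices ht hy⟩]
  split_ifs <;> simp

theorem nodalBasis_eq_zero (M : SimplicialMesh d Ω) {i : M.Node}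
    {t : Finset (EuclideanSpace ℝ (Fin d))} (ht : t ∈ M.elements) (hi : i.1 ∉ t)
    {x : EuclideanSpace ℝ (Fin d)} (hx : x ∈ cell t) : M.nodalBasis i x = 0 := by
  obtain ⟨f, hf⟩ := (M.nodalBasis_mem i).2 t ht
  rw [hf hx]
  refine affine_eqOn_convexHull (g := 0) (fun y hy => ?_) hx
  rw [← hf (mem_cell hy), M.nodalBasis_apply i ⟨y, M.mem_vertices ht hy⟩, if_neg]
  · rfl
  · rintro rfl; exact hi hy

/-- A linear function with oscillation at most `1` on `T` has gradient at most `1 / hLower T`. -/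
theorem norm_mul_hLower_le {T : Set (EuclideanSpace ℝ (Fin d))} {p : EuclideanSpace ℝ (Fin d)}
    (h : ∀ y ∈ T, ∀ z ∈ T, inner ℝ p (y - z) ≤ 1) : ‖p‖ * hLower T ≤ 1 := by
  rcases eq_or_ne p 0 with rfl | hp
  · simp
  have hp' : 0 < ‖p‖ := norm_pos_iff.2 hp
  have : sSup {r : ℝ | 0 < r ∧ ∃ x ∈ T, Metric.ball x r ⊆ T} ≤ 1 / (2 * ‖p‖) := by
    -- Nonnegativity of the bound covers an empty set of radii, whose `sSup` is 0.
    refine Real.sSup_le ?_ (by positivity)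
    rintro r ⟨hr, x, -, hx⟩
    -- The balls are open, so the test points are the antipodes `x ± s p/‖p‖` with `s < r`; they
    -- give `2 s ‖p‖ ≤ 1`.
    refine le_of_forall_lt_imp_le_of_dense fun s hs => ?_
    rcases le_or_gt s 0 with hs0 | hs0
    · exact hs0.trans (by positivity)
    have hn : ‖(s / ‖p‖) • p‖ = s := by
      rw [norm_smul, Real.norm_of_nonneg (by positivity)]; field_simp
    have h1 := h (x + (s / ‖p‖) • p) (hx (by simpa [hn] using hs))
      (x - (s / ‖p‖) • p) (hx (by simpa [dist_eq_norm, hn] using hs))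
    have e : x + (s / ‖p‖) • p - (x - (s / ‖p‖) • p) = (2 * (s / ‖p‖)) • p := by module
    rw [e, inner_smul_right, real_inner_self_eq_norm_sq] at h1
    rw [le_div_iff₀ (by positivity)]
    calc s * (2 * ‖p‖) = 2 * (s / ‖p‖) * ‖p‖ ^ 2 := by field_simp
      _ ≤ 1 := h1
  calc ‖p‖ * hLower T ≤ ‖p‖ * (2 * (1 / (2 * ‖p‖))) := by unfold hLower; gcongr
    _ = 1 := by field_simp

theorem isCompact_closure (M : SimplicialMesh d Ω) : IsCompact (closure Ω) := by
  rw [← M.space_eq]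
  exact M.finite_faces.isCompact_biUnion fun s _ =>
    s.finite_toSet.isCompact_convexHull (𝕜 := ℝ)

/-- Frontiers of convex sets are null, and there are finitely many cells. -/
theorem ae_mem_interior_cell (M : SimplicialMesh d Ω) :
    ∀ᵐ x ∂(volume.restrict Ω), x ∈ Ω → ∃ t ∈ M.elements, x ∈ interior (cell t) := by
  refine ae_restrict_of_ae ?_
  have hfin : M.elements.Finite := M.finite_faces.subset fun t ht => ht.1
  have h : ∀ᵐ x, ∀ t ∈ M.elements, x ∉ frontier (cell t) :=
    (ae_ball_iff hfin.countable).2 fun t _ =>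
      measure_eq_zero_iff_ae_notMem.1 ((convex_convexHull ℝ _).addHaar_frontier volume)
  filter_upwards [h] with x hx hxΩ
  obtain ⟨t, ht, hxt⟩ := M.exists_element_of_mem (subset_closure hxΩ)
  refine ⟨t, ht, ?_⟩
  by_contra hni
  exact hx t ht ⟨subset_closure hxt, hni⟩

/-- The finite element function with nodal values `v`. -/
noncomputable def interp (M : SimplicialMesh d Ω) (v : M.Node → ℝ) :
    EuclideanSpace ℝ (Fin d) → ℝ := ∑ i, v i • M.nodalBasis i

theorem interp_mem (M : SimplicialMesh d Ω) (v : M.Node → ℝ) : M.interp v ∈ M.feSpace :=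
  Submodule.sum_mem _ fun i _ => Submodule.smul_mem _ _ (M.nodalBasis_mem i)

theorem interp_apply (M : SimplicialMesh d Ω) (v : M.Node → ℝ) (j : M.Node) :
    M.interp v j.1 = v j := by
  simp [interp, nodalBasis_apply]

theorem gradient_interp (M : SimplicialMesh d Ω) (v : M.Node → ℝ)
    {t : Finset (EuclideanSpace ℝ (Fin d))} (ht : t ∈ M.elements)
    {x : EuclideanSpace ℝ (Fin d)} (hx : x ∈ interior (cell t)) :
    gradient (M.interp v) x = ∑ i, v i • gradient (M.nodalBasis i) x := by
  choose p hp _ using fun i => M.exists_gradient (M.nodalBasis_mem i) ht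
  have h : HasGradientAt (M.interp v) (∑ i, v i • p i) x := by
    rw [hasGradientAt_iff_hasFDerivAt, map_sum]
    simp only [map_smul]
    unfold interp
    refine HasFDerivAt.sum fun i _ => ?_
    exact ((hasGradientAt_iff_hasFDerivAt.1 (hp i x hx)).const_smul (v i))
  rw [h.gradient]
  exact Finset.sum_congr rfl fun i _ => by rw [(hp i x hx).gradient]

/-- Partition of unity: the interpolant of the constant 1 equals 1 on the cell. This is the source
of the zero row sums. -/
theorem sum_gradient_nodalBasis (M : SimplicialMesh d Ω)
    {t : Finset (EuclideanSpace ℝ (Fin d))} (ht : t ∈ M.elements)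
    {x : EuclideanSpace ℝ (Fin d)} (hx : x ∈ interior (cell t)) :
    ∑ i, gradient (M.nodalBasis i) x = 0 := by
  have h := M.gradient_interp (fun _ => 1) ht hx
  simp only [one_smul] at h
  rw [← h]
  have hc : (fun _ => 1 : EuclideanSpace ℝ (Fin d) → ℝ) ∈ M.feSpace :=
    ⟨continuousOn_const, fun _ _ => ⟨AffineMap.const ℝ _ 1, fun _ _ => rfl⟩⟩
  have he := M.feSpace_eqOn (M.interp_mem fun _ => 1) hc fun j => M.interp_apply _ j
  have : M.interp (fun _ => 1) =ᶠ[nhds x] fun _ => 1 := by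
    filter_upwards [mem_interior_iff_mem_nhds.1 hx] with y hy
    exact he (M.cell_subset ht hy)
  rw [gradient, this.fderiv_eq]
  simp

theorem gradient_nodalBasis_eq_zero (M : SimplicialMesh d Ω) {i : M.Node}
    {t : Finset (EuclideanSpace ℝ (Fin d))} (ht : t ∈ M.elements) (hi : i.1 ∉ t)
    {x : EuclideanSpace ℝ (Fin d)} (hx : x ∈ interior (cell t)) :
    gradient (M.nodalBasis i) x = 0 := by
  have : M.nodalBasis i =ᶠ[nhds x] fun _ => 0 := by
    filter_upwards [mem_interior_iff_mem_nhds.1 hx] with y hy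
    exact M.nodalBasis_eq_zero ht hi hy
  rw [gradient, this.fderiv_eq]
  simp

/-- Oscillation at most 1 bounds the gradient by `1 / hLower`; `hUpper ≤ σ * hLower` converts this
to the diameter. -/
theorem norm_gradient_nodalBasis_mul_hUpper_le (M : SimplicialMesh d Ω) {σ : ℝ} (hσ : 0 ≤ σ)
    (hM : M.IsShapeRegular σ) (i : M.Node)
    {t : Finset (EuclideanSpace ℝ (Fin d))} (ht : t ∈ M.elements)
    {x : EuclideanSpace ℝ (Fin d)} (hx : x ∈ interior (cell t)) :
    ‖gradient (M.nodalBasis i) x‖ * hUpper (cell t) ≤ σ := by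
  obtain ⟨p, hp, hp'⟩ := M.exists_gradient (M.nodalBasis_mem i) ht
  rw [(hp x hx).gradient]
  have h1 : ‖p‖ * hLower (cell t) ≤ 1 := by
    refine norm_mul_hLower_le fun y hy z hz => ?_
    rw [← hp' y hy z hz]
    linarith [(M.nodalBasis_mem_Icc i ht hy).2, (M.nodalBasis_mem_Icc i ht hz).1]
  calc ‖p‖ * hUpper (cell t) ≤ ‖p‖ * (σ * hLower (cell t)) := by gcongr; exact (hM t ht).2.2
    _ = σ * (‖p‖ * hLower (cell t)) := by ring
    _ ≤ σ := mul_le_of_le_one_right hσ h1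

theorem abs_sub_le_norm_gradient_mul_hUpper (M : SimplicialMesh d Ω)
    {u : EuclideanSpace ℝ (Fin d) → ℝ} (hu : u ∈ M.feSpace)
    {t : Finset (EuclideanSpace ℝ (Fin d))} (ht : t ∈ M.elements)
    {x : EuclideanSpace ℝ (Fin d)} (hx : x ∈ interior (cell t))
    {y z : EuclideanSpace ℝ (Fin d)} (hy : y ∈ cell t) (hz : z ∈ cell t) :
    |u y - u z| ≤ ‖gradient u x‖ * hUpper (cell t) := by
  obtain ⟨p, hp, hp'⟩ := M.exists_gradient hu ht
  rw [(hp x hx).gradient, hp' y hy z hz]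
  refine (abs_real_inner_le_norm _ _).trans ?_
  gcongr
  rw [← dist_eq_norm]
  exact Metric.dist_le_diam_of_mem (t.finite_toSet.isCompact_convexHull (𝕜 := ℝ)).isBounded hy hz

/-- The pointwise form of the bound of `A₊` by `A`. -/
theorem sum_abs_inner_gradient_mul_le (M : SimplicialMesh d Ω) {σ : ℝ} (hσ : 0 ≤ σ)
    (hM : M.IsShapeRegular σ) (v : M.Node → ℝ)
    {t : Finset (EuclideanSpace ℝ (Fin d))} (ht : t ∈ M.elements)
    {x : EuclideanSpace ℝ (Fin d)} (hx : x ∈ interior (cell t)) :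
    ∑ i, ∑ j, |inner ℝ (gradient (M.nodalBasis j) x) (gradient (M.nodalBasis i) x)| *
      (v i - v j) ^ 2 ≤ (d + 1) ^ 2 * (σ ^ 2 * ‖gradient (M.interp v) x‖ ^ 2) := by
  classical
  set P := ‖gradient (M.interp v) x‖
  set g : M.Node → EuclideanSpace ℝ (Fin d) := fun i => gradient (M.nodalBasis i) x
  -- Only the vertices of `t` have a nonzero basis gradient at `x`, which leaves at most `(d + 1) ^
  -- 2` pairs.
  let S : Finset M.Node := Finset.univ.filter fun i => i.1 ∈ t
  have hS : (S.card : ℝ) ≤ d + 1 := by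
    have : S.card ≤ t.card :=
      Finset.card_le_card_of_injOn (fun i => i.1) (fun i hi => (Finset.mem_filter.1 hi).2)
        Subtype.val_injective.injOn
    rw [ht.2] at this
    exact_mod_cast this
  have hg : ∀ i ∉ S, g i = 0 := fun i hi =>
    M.gradient_nodalBasis_eq_zero ht (by simpa [S] using hi) hx
  have hterm : ∀ i ∈ S, ∀ j ∈ S,
      |inner ℝ (g j) (g i)| * (v i - v j) ^ 2 ≤ σ ^ 2 * P ^ 2 := by
    intro i hi j hj
    have h1 : |v i - v j| ≤ P * hUpper (cell t) := by
      rw [← M.interp_apply v i, ← M.interp_apply v j]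
      exact M.abs_sub_le_norm_gradient_mul_hUpper (M.interp_mem v) ht hx
        (mem_cell (by simpa [S] using hi)) (mem_cell (by simpa [S] using hj))
    have hd : 0 ≤ hUpper (cell t) := Metric.diam_nonneg
    calc |inner ℝ (g j) (g i)| * (v i - v j) ^ 2
        ≤ (‖g j‖ * ‖g i‖) * (P * hUpper (cell t)) ^ 2 := by
          rw [← sq_abs (v i - v j)]
          gcongr
          exact abs_real_inner_le_norm _ _
      -- One diameter goes to each basis gradient, making both factors scale invariant.
      _ = (‖g j‖ * hUpper (cell t)) * (‖g i‖ * hUpper (cell t)) * P ^ 2 := by ring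
      _ ≤ σ * σ * P ^ 2 := by
          gcongr <;> exact M.norm_gradient_nodalBasis_mul_hUpper_le hσ hM _ ht hx
      _ = σ ^ 2 * P ^ 2 := by ring
  have e : ∑ i, ∑ j, |inner ℝ (g j) (g i)| * (v i - v j) ^ 2 =
      ∑ i ∈ S, ∑ j ∈ S, |inner ℝ (g j) (g i)| * (v i - v j) ^ 2 := by
    rw [← Finset.sum_subset (Finset.subset_univ S)
      (fun i _ hi => Finset.sum_eq_zero fun j _ => by simp [hg i hi])]
    exact Finset.sum_congr rfl fun i _ => (Finset.sum_subset (Finset.subset_univ S)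
      (fun j _ hj => by simp [hg j hj])).symm
  rw [e]
  calc _ ≤ ∑ i ∈ S, ∑ j ∈ S, σ ^ 2 * P ^ 2 :=
        Finset.sum_le_sum fun i hi => Finset.sum_le_sum fun j hj => hterm i hi j hj
    _ = (S.card : ℝ) ^ 2 * (σ ^ 2 * P ^ 2) := by simp; ring
    _ ≤ _ := by gcongr

end SimplicialMesh

/-! ### The stiffness matrix: integrability, row sums, energy and kernel. -/

namespace SimplicialMesh

variable {d : ℕ} {Ω : Set (EuclideanSpace ℝ (Fin d))}

theorem measurable_gradient (u : EuclideanSpace ℝ (Fin d) → ℝ) : Measurable (gradient u) :=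
  (InnerProductSpace.toDual ℝ (EuclideanSpace ℝ (Fin d))).symm.continuous.measurable.comp
    (measurable_fderiv ℝ u)

theorem ae_exists_mem_interior_cell (M : SimplicialMesh d Ω) (hΩ : IsOpen Ω) :
    ∀ᵐ x ∂(volume.restrict Ω), ∃ t ∈ M.elements, x ∈ interior (cell t) := by
  filter_upwards [M.ae_mem_interior_cell, ae_restrict_mem hΩ.measurableSet] with x h hx
  exact h hx

theorem exists_norm_gradient_le (M : SimplicialMesh d Ω) {u : EuclideanSpace ℝ (Fin d) → ℝ}
    (hu : u ∈ M.feSpace) :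
    ∃ B, 0 ≤ B ∧ ∀ t ∈ M.elements, ∀ x ∈ interior (cell t), ‖gradient u x‖ ≤ B := by
  have hfin : M.elements.Finite := M.finite_faces.subset fun t ht => ht.1
  have := hfin.to_subtype
  choose p hp _ using fun t : M.elements => M.exists_gradient hu t.2
  obtain ⟨B, hB⟩ := (Set.finite_range fun t => ‖p t‖).bddAbove
  refine ⟨max B 0, le_max_right _ _, fun t ht x hx => ?_⟩
  rw [(hp ⟨t, ht⟩ x hx).gradient]
  exact (hB ⟨⟨t, ht⟩, rfl⟩).trans (le_max_left _ _)

theorem integrable_inner_gradient (M : SimplicialMesh d Ω) (hΩ : IsOpen Ω)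
    {a : EuclideanSpace ℝ (Fin d) → ℝ} (ha : AEStronglyMeasurable a (volume.restrict Ω))
    {α₀ α₁ : ℝ} (hα : 0 < α₀) (hab : ∀ᵐ x ∂(volume.restrict Ω), α₀ ≤ a x ∧ a x ≤ α₁)
    {u w : EuclideanSpace ℝ (Fin d) → ℝ} (hu : u ∈ M.feSpace) (hw : w ∈ M.feSpace) :
    Integrable (fun x => a x * inner ℝ (gradient u x) (gradient w x)) (volume.restrict Ω) := by
  obtain ⟨B, hB0, hB⟩ := M.exists_norm_gradient_le hu
  obtain ⟨B', _, hB'⟩ := M.exists_norm_gradient_le hw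
  -- Boundedness of `Ω` comes from the mesh: its closure is a finite union of simplices.
  have hμ : volume Ω < ⊤ := (measure_mono subset_closure).trans_lt M.isCompact_closure.measure_lt_top
  have : IsFiniteMeasure (volume.restrict Ω) := ⟨by simpa using hμ⟩
  refine Integrable.of_bound (C := α₁ * (B * B')) (ha.mul
    ((measurable_gradient u).inner (measurable_gradient w)).aestronglyMeasurable) ?_
  filter_upwards [hab, M.ae_exists_mem_interior_cell hΩ] with x hx ⟨t, ht, hxt⟩
  have ha0 : 0 ≤ a x := hα.le.trans hx.1
  rw [norm_mul, Real.norm_of_nonneg ha0]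
  have h1 : ‖(inner ℝ (gradient u x) (gradient w x) : ℝ)‖ ≤ B * B' :=
    (norm_inner_le_norm _ _).trans
      (mul_le_mul (hB t ht x hxt) (hB' t ht x hxt) (norm_nonneg _) hB0)
  exact mul_le_mul hx.2 h1 (norm_nonneg _) (ha0.trans hx.2)

theorem stiffness_symm (M : SimplicialMesh d Ω) (a : EuclideanSpace ℝ (Fin d) → ℝ)
    (i j : M.Node) : M.stiffness a i j = M.stiffness a j i := by
  simp only [stiffness, Matrix.of_apply, energyForm, real_inner_comm]

theorem stiffness_eq_zero (M : SimplicialMesh d Ω) (hΩ : IsOpen Ω)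
    (a : EuclideanSpace ℝ (Fin d) → ℝ) {i j : M.Node} (hij : i ≠ j)
    (h : ¬ M.edgeGraph.Adj i j) : M.stiffness a i j = 0 := by
  refine integral_eq_zero_of_ae ?_
  filter_upwards [M.ae_exists_mem_interior_cell hΩ] with x ⟨t, ht, hxt⟩
  by_cases hi : i.1 ∈ t
  · have hj : j.1 ∉ t := fun hj => h ⟨hij, t, ht.1, hi, hj⟩
    simp [M.gradient_nodalBasis_eq_zero ht hj hxt]
  · simp [M.gradient_nodalBasis_eq_zero ht hi hxt]

theorem sum_stiffness (M : SimplicialMesh d Ω) (hΩ : IsOpen Ω)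
    {a : EuclideanSpace ℝ (Fin d) → ℝ} (ha : AEStronglyMeasurable a (volume.restrict Ω))
    {α₀ α₁ : ℝ} (hα : 0 < α₀) (hab : ∀ᵐ x ∂(volume.restrict Ω), α₀ ≤ a x ∧ a x ≤ α₁)
    (i : M.Node) : ∑ j, M.stiffness a i j = 0 := by
  simp only [stiffness, Matrix.of_apply, energyForm]
  rw [← integral_finsetSum _ fun j _ => M.integrable_inner_gradient hΩ ha hα hab
    (M.nodalBasis_mem j) (M.nodalBasis_mem i)]
  refine integral_eq_zero_of_ae ?_
  filter_upwards [M.ae_exists_mem_interior_cell hΩ] with x ⟨t, ht, hxt⟩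
  rw [← Finset.mul_sum, ← sum_inner, M.sum_gradient_nodalBasis ht hxt]
  simp

theorem aInner_stiffness (M : SimplicialMesh d Ω) (hΩ : IsOpen Ω)
    {a : EuclideanSpace ℝ (Fin d) → ℝ} (ha : AEStronglyMeasurable a (volume.restrict Ω))
    {α₀ α₁ : ℝ} (hα : 0 < α₀) (hab : ∀ᵐ x ∂(volume.restrict Ω), α₀ ≤ a x ∧ a x ≤ α₁)
    (v : M.Node → ℝ) :
    aInner (M.stiffness a) v v = energyForm Ω a (M.interp v) (M.interp v) := by
  have hint := fun i j => M.integrable_inner_gradient hΩ ha hα hab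
    (M.nodalBasis_mem j) (M.nodalBasis_mem i)
  have e : aInner (M.stiffness a) v v = ∑ i, ∑ j, ∫ x in Ω, v j * v i *
      (a x * inner ℝ (gradient (M.nodalBasis j) x) (gradient (M.nodalBasis i) x)) := by
    simp only [aInner, dotProduct, Matrix.mulVec, Finset.sum_mul, stiffness, Matrix.of_apply,
      energyForm, integral_const_mul]
    exact Finset.sum_congr rfl fun i _ => Finset.sum_congr rfl fun j _ => by ring
  rw [e, energyForm]
  simp only [← integral_finsetSum _ fun j _ => (hint _ j).const_mul _]
  rw [← integral_finsetSum _ fun i _ => integrable_finsetSum _ fun j _ => (hint i j).const_mul _]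
  refine integral_congr_ae ?_
  filter_upwards [M.ae_exists_mem_interior_cell hΩ] with x ⟨t, ht, hxt⟩
  rw [M.gradient_interp v ht hxt]
  simp only [sum_inner, inner_sum, inner_smul_left, inner_smul_right, Finset.mul_sum]
  refine Finset.sum_congr rfl fun i _ => Finset.sum_congr rfl fun j _ => ?_
  rw [conj_trivial]
  ring

theorem energyForm_self_nonneg {a : EuclideanSpace ℝ (Fin d) → ℝ}
    {α₀ α₁ : ℝ} (hα : 0 < α₀) (hab : ∀ᵐ x ∂(volume.restrict Ω), α₀ ≤ a x ∧ a x ≤ α₁)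
    (u : EuclideanSpace ℝ (Fin d) → ℝ) : 0 ≤ energyForm Ω a u u := by
  refine integral_nonneg_of_ae ?_
  filter_upwards [hab] with x hx
  exact mul_nonneg (hα.le.trans hx.1) real_inner_self_nonneg

/-- A finite element function of zero energy is constant on every element. -/
theorem eq_of_energyForm_eq_zero (M : SimplicialMesh d Ω) (hΩ : IsOpen Ω)
    {a : EuclideanSpace ℝ (Fin d) → ℝ} (ha : AEStronglyMeasurable a (volume.restrict Ω))
    {α₀ α₁ : ℝ} (hα : 0 < α₀) (hab : ∀ᵐ x ∂(volume.restrict Ω), α₀ ≤ a x ∧ a x ≤ α₁)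
    {u : EuclideanSpace ℝ (Fin d) → ℝ} (hu : u ∈ M.feSpace) (h0 : energyForm Ω a u u = 0)
    {t : Finset (EuclideanSpace ℝ (Fin d))} (ht : t ∈ M.elements)
    {y z : EuclideanSpace ℝ (Fin d)} (hy : y ∈ cell t) (hz : z ∈ cell t) : u y = u z := by
  obtain ⟨p, hp, hp'⟩ := M.exists_gradient hu ht
  have hae : ∀ᵐ x ∂(volume.restrict Ω), gradient u x = 0 := by
    have h1 := (integral_eq_zero_iff_of_nonneg_ae (by
      filter_upwards [hab] with x hx
      exact mul_nonneg (hα.le.trans hx.1) real_inner_self_nonneg)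
      (M.integrable_inner_gradient hΩ ha hα hab hu hu)).1 h0
    filter_upwards [h1, hab] with x hx hx'
    rcases mul_eq_zero.1 hx with h | h
    · linarith [hx'.1]
    · exact inner_self_eq_zero.1 h
  have hp0 : p = 0 := by
    obtain ⟨x, hx⟩ := M.interior_cell_nonempty ht
    -- The interior of a cell need not lie in `Ω`, only in its closure; being open it still meets
    -- `Ω`, in a set of positive measure.
    have hne : (interior (cell t) ∩ Ω).Nonempty :=
      mem_closure_iff.1 (M.cell_subset ht (interior_subset hx)) _ isOpen_interior hx
    have hpos : 0 < volume (interior (cell t) ∩ Ω) :=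
      (isOpen_interior.inter hΩ).measure_pos volume hne
    by_contra hp0
    have hsub : interior (cell t) ∩ Ω ⊆ {x | ¬ (x ∈ Ω → gradient u x = 0)} := by
      rintro x ⟨hx, hxΩ⟩ h
      exact hp0 ((hp x hx).gradient.symm.trans (h hxΩ))
    rw [ae_restrict_iff' hΩ.measurableSet, ae_iff] at hae
    exact hpos.ne' (measure_mono_null hsub hae)
  have := hp' y hy z hz
  rw [hp0, inner_zero_left] at this
  linarith

/-- Zero energy would make `φ_i` constant on an element at `x_i`, but for `d ≥ 1` that element has
another vertex, where `φ_i` vanishes. -/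
theorem stiffness_diag_pos (M : SimplicialMesh d Ω) (hd : 1 ≤ d) (hΩ : IsOpen Ω)
    {a : EuclideanSpace ℝ (Fin d) → ℝ} (ha : AEStronglyMeasurable a (volume.restrict Ω))
    {α₀ α₁ : ℝ} (hα : 0 < α₀) (hab : ∀ᵐ x ∂(volume.restrict Ω), α₀ ≤ a x ∧ a x ≤ α₁)
    (i : M.Node) : 0 < M.stiffness a i i := by
  refine lt_of_le_of_ne (energyForm_self_nonneg hα hab _) fun h => ?_
  obtain ⟨t, ht, hi⟩ := M.exists_element_of_node i
  obtain ⟨y, hy, hne⟩ := Finset.exists_mem_ne (by rw [ht.2]; omega) i.1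
  have h1 := M.eq_of_energyForm_eq_zero hΩ ha hα hab (M.nodalBasis_mem i) h.symm ht
    (mem_cell hi) (mem_cell hy)
  rw [M.nodalBasis_apply i i, M.nodalBasis_apply i ⟨y, M.mem_vertices ht hy⟩, if_pos rfl,
    if_neg (fun e => hne (congrArg Subtype.val e).symm)] at h1
  exact one_ne_zero h1

/-- The pointwise gradient bound is multiplied by `a x ≥ 0` and integrated; `1 / 2` is the double
count of edges. -/
theorem plusForm_le_aInner_stiffness (M : SimplicialMesh d Ω) {σ : ℝ} (hσ : 0 ≤ σ)
    (hM : M.IsShapeRegular σ) (hΩ : IsOpen Ω)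
    {a : EuclideanSpace ℝ (Fin d) → ℝ} (ha : AEStronglyMeasurable a (volume.restrict Ω))
    {α₀ α₁ : ℝ} (hα : 0 < α₀) (hab : ∀ᵐ x ∂(volume.restrict Ω), α₀ ≤ a x ∧ a x ≤ α₁)
    (v : M.Node → ℝ) :
    plusForm M.edgeGraph (M.stiffness a) v v ≤
      (1 / 2) * ((d + 1) ^ 2 * σ ^ 2) * aInner (M.stiffness a) v v := by
  have hint := fun i j => M.integrable_inner_gradient hΩ ha hα hab
    (M.nodalBasis_mem j) (M.nodalBasis_mem i)
  have habs : ∀ i j, |M.stiffness a i j| ≤ ∫ x in Ω,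
      |a x * inner ℝ (gradient (M.nodalBasis j) x) (gradient (M.nodalBasis i) x)| :=
    fun i j => abs_integral_le_integral_abs
  rw [plusForm_self_eq _ fun i j hij h => by
    by_contra hn; exact h.ne (M.stiffness_eq_zero hΩ a hij hn), mul_assoc (1 / 2)]
  refine mul_le_mul_of_nonneg_left ?_ (by norm_num)
  calc ∑ i, ∑ j, max (-M.stiffness a i j) 0 * (v i - v j) * (v i - v j)
      ≤ ∑ i, ∑ j, ∫ x in Ω, |a x * inner ℝ (gradient (M.nodalBasis j) x)
          (gradient (M.nodalBasis i) x)| * (v i - v j) ^ 2 := by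
        refine Finset.sum_le_sum fun i _ => Finset.sum_le_sum fun j _ => ?_
        rw [integral_mul_const, mul_assoc, ← sq]
        exact mul_le_mul_of_nonneg_right
          ((max_le (neg_le_abs _) (abs_nonneg _)).trans (habs i j)) (sq_nonneg _)
    _ = ∫ x in Ω, ∑ i, ∑ j, |a x * inner ℝ (gradient (M.nodalBasis j) x)
          (gradient (M.nodalBasis i) x)| * (v i - v j) ^ 2 := by
        simp only [← integral_finsetSum _ fun j _ => (hint _ j).abs.mul_const _]
        rw [← integral_finsetSum _ fun i _ =>
          integrable_finsetSum _ fun j _ => (hint i j).abs.mul_const _]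
    _ ≤ ∫ x in Ω, (d + 1) ^ 2 * σ ^ 2 * (a x * inner ℝ (gradient (M.interp v) x)
          (gradient (M.interp v) x)) := by
        refine integral_mono_ae (integrable_finsetSum _ fun i _ =>
          integrable_finsetSum _ fun j _ => (hint i j).abs.mul_const _)
          ((M.integrable_inner_gradient hΩ ha hα hab (M.interp_mem v)
            (M.interp_mem v)).const_mul _) ?_
        filter_upwards [hab, M.ae_exists_mem_interior_cell hΩ] with x hx ⟨t, ht, hxt⟩
        have ha0 : 0 ≤ a x := hα.le.trans hx.1
        have := mul_le_mul_of_nonneg_left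
          (M.sum_abs_inner_gradient_mul_le hσ hM v ht hxt) ha0
        simp only [abs_mul, abs_of_nonneg ha0, mul_assoc (a x), ← Finset.mul_sum,
          real_inner_self_eq_norm_sq]
        linarith
    _ = _ := by rw [integral_const_mul, M.aInner_stiffness hΩ ha hα hab]; rfl

/-- A finite element function of zero energy has constant nodal values, since the mesh fills out a
connected set. -/
theorem eq_of_aInner_stiffness_eq_zero (M : SimplicialMesh d Ω) (hΩ : IsOpen Ω)
    (hc : IsConnected Ω)
    {a : EuclideanSpace ℝ (Fin d) → ℝ} (ha : AEStronglyMeasurable a (volume.restrict Ω))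
    {α₀ α₁ : ℝ} (hα : 0 < α₀) (hab : ∀ᵐ x ∂(volume.restrict Ω), α₀ ≤ a x ∧ a x ≤ α₁)
    {v : M.Node → ℝ} (h0 : aInner (M.stiffness a) v v = 0) (i j : M.Node) : v i = v j := by
  rw [M.aInner_stiffness hΩ ha hα hab] at h0
  have hval : ∀ x ∈ closure Ω, M.interp v x ∈ Set.range v := by
    intro x hx
    obtain ⟨t, ht, hxt⟩ := M.exists_element_of_mem hx
    obtain ⟨y, hy⟩ := Finset.card_pos.1 (by rw [ht.2]; omega : 0 < t.card)
    refine ⟨⟨y, M.mem_vertices ht hy⟩, ?_⟩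
    rw [← M.interp_apply v]
    exact M.eq_of_energyForm_eq_zero hΩ ha hα hab (M.interp_mem v) h0 ht (mem_cell hy) hxt
  have hmem : ∀ k : M.Node, k.1 ∈ closure Ω := by
    intro k
    obtain ⟨t, ht, hk⟩ := M.exists_element_of_node k
    exact M.cell_subset ht (mem_cell hk)
  -- The image is a connected subset of `ℝ` contained in the finite set of nodal values, hence a
  -- single point. No chain of neighbouring elements is needed.
  have hsub : (M.interp v '' closure Ω).Subsingleton := by
    by_contra h
    exact (hc.closure.isPreconnected.image _ (M.interp_mem v).1).infinite_of_nontrivial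
      (Set.not_subsingleton_iff.1 h) ((Set.finite_range v).subset (Set.image_subset_iff.2 hval))
  rw [← M.interp_apply v i, ← M.interp_apply v j]
  exact hsub (Set.mem_image_of_mem _ (hmem i)) (Set.mem_image_of_mem _ (hmem j))

end SimplicialMesh

/-! ### Assembly of the theorem. -/

theorem mainTheorem4 (σ : ℝ) (hσ : 1 ≤ σ) :
    ∃ c C : ℝ, 0 < c ∧ 0 < C ∧
      ∀ (d : ℕ), 1 ≤ d → d ≤ 3 →
      ∀ (Ω : Set (EuclideanSpace ℝ (Fin d))), IsOpen Ω → IsConnected Ω →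
      ∀ (M : SimplicialMesh d Ω), M.IsShapeRegular σ →
      ∀ (a : EuclideanSpace ℝ (Fin d) → ℝ),
        AEStronglyMeasurable a (volume.restrict Ω) →
        (∃ α₀ α₁ : ℝ, 0 < α₀ ∧ 0 < α₁ ∧ ∀ᵐ x ∂(volume.restrict Ω), α₀ ≤ a x ∧ a x ≤ α₁) →
        plusMatrix M.edgeGraph (M.stiffness a) = diagCompensated (M.stiffness a) ∧
        IsMMatrixRelative C (M.stiffness a) (plusMatrix M.edgeGraph (M.stiffness a)) ∧
        SpectrallyEquivalent c C (M.stiffness a) (plusMatrix M.edgeGraph (M.stiffness a)) ∧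
        (matrixGraph (plusMatrix M.edgeGraph (M.stiffness a))).Connected := by
  -- `8 σ² = ½ (d + 1)² σ²` at `d = 3`.
  refine ⟨1, 8 * σ ^ 2, one_pos, by positivity, ?_⟩
  rintro d hd hd3 Ω hΩ hc M hM a ha ⟨α₀, α₁, hα, -, hab⟩
  have hC : 1 ≤ 8 * σ ^ 2 := by nlinarith
  have hs := M.stiffness_symm a
  have h0 := M.sum_stiffness hΩ ha hα hab
  have hadj : ∀ i j, i ≠ j → M.stiffness a i j < 0 → M.edgeGraph.Adj i j := by
    intro i j hij h
    by_contra hn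
    exact h.ne (M.stiffness_eq_zero hΩ a hij hn)
  have hpos := M.stiffness_diag_pos hd hΩ ha hα hab
  have hnn : ∀ v, 0 ≤ aInner (M.stiffness a) v v := fun v => by
    rw [M.aInner_stiffness hΩ ha hα hab]
    exact SimplicialMesh.energyForm_self_nonneg hα hab _
  have heq := plusMatrix_eq_diagCompensated M.edgeGraph hs h0 hadj
  have hlower : ∀ v, aInner (M.stiffness a) v v ≤
      aInner (plusMatrix M.edgeGraph (M.stiffness a)) v v := fun v => by
    rw [aInner_plusMatrix]
    exact aInner_le_plusForm _ hs h0 hadj v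
  have hupper : ∀ v, aInner (plusMatrix M.edgeGraph (M.stiffness a)) v v ≤
      8 * σ ^ 2 * aInner (M.stiffness a) v v := fun v => by
    rw [aInner_plusMatrix]
    refine (M.plusForm_le_aInner_stiffness (by linarith) hM hΩ ha hα hab v).trans
      (mul_le_mul_of_nonneg_right ?_ (hnn v))
    have h4 : ((d : ℝ) + 1) ^ 2 ≤ 4 ^ 2 := by
      have : (d : ℝ) ≤ 3 := by exact_mod_cast hd3
      gcongr
      linarith
    nlinarith [mul_le_mul_of_nonneg_right h4 (sq_nonneg σ)]
  refine ⟨heq, ⟨?_, hupper, ?_⟩, fun v => ⟨by rw [one_mul]; exact hlower v, hupper v⟩, ?_⟩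
  · rw [heq]
    refine isMMatrix_diagCompensated hs hpos fun v => ?_
    rw [← heq]
    exact (hnn v).trans (hlower v)
  · rw [heq]
    exact aInner_diagPart_le hC hpos
  · obtain ⟨x, hx⟩ := hc.nonempty
    obtain ⟨t, ht, -⟩ := M.exists_element_of_mem (subset_closure hx)
    obtain ⟨y, hy⟩ := Finset.card_pos.1 (by rw [ht.2]; omega : 0 < t.card)
    have : Nonempty M.Node := ⟨⟨y, M.mem_vertices ht hy⟩⟩
    refine matrixGraph_plusMatrix_connected _ hs h0 hadj fun v hv => ?_
    -- Zero energy for `A₊` forces zero energy for `A`, because `0 ≤ A ≤ A₊`.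
    refine M.eq_of_aInner_stiffness_eq_zero hΩ hc ha hα hab (le_antisymm ?_ (hnn v))
    rw [← hv]
    exact aInner_le_plusForm _ hs h0 hadj v
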